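/- Graphs are finite and simple, and the spectrum of a graph is the multiset of eigenvalues (with multiplicity) of its adjacency matrix. A threshold graph is a graph obtained from a single vertex by repeatedly adding either an isolated vertex or a dominating vertex (one adjacent to all the vertices already present); its binary sequence has, in the order of construction, a digit $0$ for the first vertex and for each vertex added as isolated, and a digit $1$ for each vertex added as dominating. Theorem. No two nonisomorphic threshold graphs have the same adjacency spectrum: if $G$ and $G'$ are threshold graphs with the same spectrum, then $G\cong G'$. Moreover, let $n$ and $m$ be even, let $a_1,\dots,a_n$ and $b_1,\dots,b_m$ be positive integers, and let $G$ and $G'$ be threshold graphs with binary sequences $(0^{a_1}1^{a_2}\cdots 0^{a_{n-1}}1^{a_n})$ and $(0^{b_1}1^{b_2}\cdots 0^{b_{m-1}}1^{b_m})$. If $G$ and $G'$ have the same spectrum, then $n=m$ and $a_i=b_i$ for all $i=1,\dots,n$. -/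

import Mathlib

namespace Threshold

/-- The spectrum of the adjacency matrix of a finite simple graph: the multiset of the real
roots of its characteristic polynomial, repeated according to multiplicity. (The matrix is real
symmetric, so that this multiset holds all `|V|` eigenvalues.) -/
noncomputable def adjSpectrum {V : Type*} [Fintype V] [DecidableEq V] (G : SimpleGraph V)
    [DecidableRel G.Adj] : Multiset ℝ :=
  (G.adjMatrix ℝ).charpoly.roots

/-- `HasBinarySequence G s`: the graph `G` is obtained by adding its vertices
`v₀, v₁, …` one after the other, in the order given by `e`, where `vᵢ` is added as a dominating
vertex (adjacent to all earlier vertices) if the digit `s[i]` is `1` (`true`), and as an isolated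
vertex (adjacent to no earlier vertex) if it is `0` (`false`). The digit of the first vertex has
no influence. -/
def HasBinarySequence {V : Type*} (G : SimpleGraph V) (s : List Bool) : Prop :=
  ∃ e : Fin s.length ≃ V, ∀ i j : Fin s.length, j < i → (G.Adj (e j) (e i) ↔ s.get i = true)

/-- A threshold graph: a graph that arises from a single vertex by repeatedly adding an isolated
or a dominating vertex. -/
def IsThreshold {V : Type*} (G : SimpleGraph V) : Prop :=
  ∃ s : List Bool, s ≠ [] ∧ HasBinarySequence G s

/-- The binary sequence `d^{a₁} (1-d)^{a₂} d^{a₃} …` with blocks of lengths `a₁, a₂, …` of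
alternating digits, the first one being `d`. -/
def blocksFrom : Bool → List ℕ → List Bool
  | _, [] => []
  | d, k :: a => List.replicate k d ++ blocksFrom (!d) a

/-- The binary sequence `0^{a₁} 1^{a₂} 0^{a₃} 1^{a₄} …`. -/
def blockSequence (a : List ℕ) : List Bool :=
  blocksFrom false a

end Threshold

/-!
Let `P = det (X - A)` and `Q = det (X - A + J)`, where `A` is the adjacency matrix and `J` the
all-ones matrix. Adding an isolated or a dominating vertex acts on the pair `(P, Q)` by a `2 × 2`
matrix over `ℝ[X]` (`det_charmat`), so that the characteristic polynomial of a threshold graph is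
an entry of a product of such matrices, one for each digit.

For a binary sequence `0^{a₁} 1^{a₂} ⋯ 0^{a₂ₘ₋₁} 1^{a₂ₘ} 0^c`, collecting the blocks gives
`P = X ^ α * (X + 1) ^ β * (f(T) + X g(T))` with `T = X (X + 1)`, where `f` and `g` are
continuants of the block lengths with alternating signs (`exists_foldl_step_blockSequence`). The main factor
`R = f(T) + X g(T)` does not vanish at `0`, and `-1` is at most a simple root of it. Since
`α + β + 2m` is the number of vertices, a comparison of the roots `0` and `-1` together with the
parity of `β` shows that `P` determines `R` (`mainFactor_eq_of_mul_eq`). As `ℝ[X]` is free over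
`ℝ[T]` with basis `1, X`, the polynomial `R` determines `f` and `g`
(`continuants_eq_of_mainFactor_eq`), and the continued fraction expansion of `f / g` gives back
`a₁, …, a₂ₘ` (`continuants_injective`). Finally `c` follows from the number of vertices. Every
threshold graph has such a sequence, because the digit of its first vertex may be taken to be `0`.
-/

namespace Threshold

open Polynomial Matrix

/-! ### Determinants of matrices with a constant border -/

section Bordered

variable {R n : Type*} [CommRing R] [Fintype n] [DecidableEq n]

/-- The matrix `B` bordered by one further row and column, whose entries are all `c` except
for the corner entry `d`. -/
def bordered (B : Matrix n n R) (c d : R) : Matrix (n ⊕ Fin 1) (n ⊕ Fin 1) R :=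
  fromBlocks B (of fun _ _ => c) (of fun _ _ => c) (of fun _ _ => d)

theorem det_bordered_zero (B : Matrix n n R) (d : R) :
    (bordered B 0 d).det = d * B.det := by
  have h : (of fun _ _ => 0 : Matrix n (Fin 1) R) = 0 := rfl
  rw [bordered, h, det_fromBlocks_zero₁₂, det_fin_one, of_apply, mul_comm]

theorem det_bordered_corner_add (B : Matrix n n R) (c d e : R) :
    (bordered B c (d + e)).det = d * B.det + (bordered B c e).det := by
  have h : ∀ u : n ⊕ Fin 1 → R, (bordered B c e).updateRow (Sum.inr 0) u =
      fromBlocks B (of fun _ _ => c) (of fun _ j => u (Sum.inl j))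
        (of fun _ j => u (Sum.inr j)) := by
    intro u
    ext i j
    rcases i with i | i
    · rcases j with j | j <;> simp [bordered, updateRow_apply]
    · rw [Subsingleton.elim i 0]
      rcases j with j | j <;> simp [updateRow_apply]
  have h0 : (of fun _ _ => 0 : Matrix (Fin 1) n R) = 0 := rfl
  have key := det_updateRow_add (bordered B c e) (Sum.inr 0) (Sum.elim (fun _ => 0) (fun _ => d))
    (Sum.elim (fun _ => c) (fun _ => e))
  simp only [h, Pi.add_apply, Sum.elim_inl, Sum.elim_inr, zero_add, h0] at key
  rw [det_fromBlocks_zero₂₁, det_fin_one, of_apply, mul_comm] at key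
  exact key

theorem det_bordered_one_one (B : Matrix n n R) :
    (bordered (B + of fun _ _ => 1) 1 1).det = B.det := by
  have h : (of fun _ _ => 1 : Matrix (Fin 1) (Fin 1) R) = 1 := by
    ext i j
    rw [Subsingleton.elim i j]
    simp
  rw [bordered, h, det_fromBlocks_one₂₂]
  congr 1
  ext i j
  simp [mul_apply]

theorem det_bordered_neg_one_neg_one (B : Matrix n n R) :
    (bordered B (-1) (-1)).det = -(B + of fun _ _ => 1).det := by
  have h : (of fun _ _ => -1 : Matrix (Fin 1) (Fin 1) R) = -1 := by
    ext i j
    rw [Subsingleton.elim i j]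
    simp
  let : Invertible (1 : Matrix (Fin 1) (Fin 1) R) := invertibleOne
  let : Invertible (-1 : Matrix (Fin 1) (Fin 1) R) := invertibleNeg 1
  rw [bordered, h, det_fromBlocks₂₂, invOf_neg, invOf_one]
  have h' : B - (of fun _ _ => -1 : Matrix n (Fin 1) R) * (-1 : Matrix (Fin 1) (Fin 1) R) *
      (of fun _ _ => -1 : Matrix (Fin 1) n R) = B + of fun _ _ => 1 := by
    rw [Matrix.mul_neg, Matrix.mul_one]
    ext i j
    simp [mul_apply]
  rw [h']
  simp

end Bordered

/-! ### The characteristic polynomial as a product of transfer matrices -/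

/-- The effect of adding one vertex with the given digit to a graph with adjacency matrix `A` on
the pair `(det (X - A), det (X - A + J))`, where `J` is the all-ones matrix. -/
noncomputable def step (v : ℝ[X] × ℝ[X]) : Bool → ℝ[X] × ℝ[X]
  | false => (X * v.1, X * v.2 + v.1)
  | true => ((X + 1) * v.1 - v.2, (X + 1) * v.2)

/-- The matrix `X - A` for the graph on `Fin n` in which `i < j` are adjacent if and only if the
digit `d j` is `1`. -/
noncomputable def charmat (d : ℕ → Bool) (n : ℕ) : Matrix (Fin n) (Fin n) ℝ[X] :=
  of fun i j => if i = j then X else if d (max i j) then -1 else 0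

theorem charmat_succ (d : ℕ → Bool) (n : ℕ) :
    (charmat d (n + 1)).submatrix finSumFinEquiv finSumFinEquiv =
      bordered (charmat d n) (if d n then -1 else 0) X := by
  ext1 i j
  rcases i with i | i <;> rcases j with j | j
  · simp [charmat, bordered]
  · have : (i : ℕ) ≤ n := i.2.le
    have h : Fin.castAdd 1 i ≠ Fin.natAdd n j := by
      intro h; have := congrArg Fin.val h; simp at this; omega
    simp [charmat, bordered, h, this]
  · have : (j : ℕ) ≤ n := j.2.le
    have h : Fin.natAdd n i ≠ Fin.castAdd 1 j := by
      intro h; have := congrArg Fin.val h; simp at this; omega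
    simp [charmat, bordered, h, this]
  · rw [Subsingleton.elim i j]
    simp [charmat, bordered]

theorem bordered_add_ones {R n : Type*} [CommRing R] (B : Matrix n n R) (c d : R) :
    bordered B c d + of (fun _ _ => 1) = bordered (B + of fun _ _ => 1) (c + 1) (d + 1) := by
  ext i j
  rcases i with i | i <;> rcases j with j | j <;> simp [bordered]

theorem det_charmat (d : ℕ → Bool) (n : ℕ) :
    ((charmat d n).det, (charmat d n + of fun _ _ => 1).det) =
      ((List.range n).map d).foldl step (1, 1) := by
  induction n with
  | zero => simp
  | succ n ih =>
    have h1 : (charmat d (n + 1)).det = (bordered (charmat d n) (if d n then -1 else 0) X).det := by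
      rw [← charmat_succ, det_submatrix_equiv_self]
    have h2 : (charmat d (n + 1) + of fun _ _ => 1).det =
        (bordered (charmat d n + of fun _ _ => 1) ((if d n then -1 else 0) + 1) (X + 1)).det := by
      rw [← bordered_add_ones, ← charmat_succ, ← det_submatrix_equiv_self finSumFinEquiv]
      rfl
    rw [List.range_succ, List.map_append, List.foldl_append, ← ih, h1, h2]
    cases hd : d n
    · simp [step, hd, det_bordered_zero, det_bordered_corner_add, det_bordered_one_one]
    · have h3 := det_bordered_corner_add (charmat d n) (-1) (X + 1) (-1)
      rw [add_neg_cancel_right, det_bordered_neg_one_neg_one] at h3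
      simp [step, hd, det_bordered_zero, h3, sub_eq_add_neg]

theorem HasBinarySequence.charpoly_adjMatrix {V : Type*} [Fintype V] [DecidableEq V]
    {G : SimpleGraph V} [DecidableRel G.Adj] {s : List Bool} (h : HasBinarySequence G s) :
    (G.adjMatrix ℝ).charpoly = (s.foldl step (1, 1)).1 := by
  obtain ⟨e, he⟩ := h
  have hs : (List.range s.length).map (fun i => s.getD i false) = s := by
    apply List.ext_getElem
    · simp
    · intro i h₁ h₂
      simp [List.getElem?_eq_getElem h₂]
  have hdet := congrArg Prod.fst (det_charmat (fun i => s.getD i false) s.length)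
  rw [hs] at hdet
  rw [← hdet, Matrix.charpoly, ← det_submatrix_equiv_self e]
  congr 1
  ext1 i j
  rcases lt_trichotomy i j with hij | rfl | hij
  · have h1 := he j i hij
    have h2 : max (i : ℕ) j = j := max_eq_right hij.le
    by_cases h3 : s[(j : ℕ)] = true <;>
    simp_all [charmat, hij.ne, SimpleGraph.adjMatrix_apply]
  · simp [charmat]
  · have h1 := (G.adj_comm _ _).trans (he i j hij)
    have h2 : max (i : ℕ) j = i := max_eq_left hij.le
    by_cases h3 : s[(i : ℕ)] = true <;>
    simp_all [charmat, hij.ne', SimpleGraph.adjMatrix_apply]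

/-! ### Continuants of a block sequence -/

/-- For a list `a₁, …, a₂ₘ`, the numerator and the denominator of the continued fraction
`a₁ + T / (-a₂ + T / (a₃ + T / (-a₄ + ⋯)))`, as polynomials in the variable `T`. On lists of odd
length the value is irrelevant. -/
noncomputable def continuants : List ℕ → ℝ[X] × ℝ[X]
  | a :: b :: l =>
    let f := (continuants l).1
    let g := X * (continuants l).2 - (b : ℝ[X]) * f
    (X * f + (a : ℝ[X]) * g, g)
  | _ => (1, 0)

theorem continuants_cons_cons (a b : ℕ) (l : List ℕ) :
    continuants (a :: b :: l) =
      (X * (continuants l).1 + (a : ℝ[X]) * (X * (continuants l).2 - (b : ℝ[X]) * (continuants l).1),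
        X * (continuants l).2 - (b : ℝ[X]) * (continuants l).1) := rfl

theorem eval_zero_continuants_ne_zero :
    ∀ l : List ℕ, (∀ k ∈ l, 0 < k) → (continuants l).1.eval 0 ≠ 0
  | [], _ => by simp [continuants]
  | [_], _ => by simp [continuants]
  | a :: b :: l, h => by
    have ih := eval_zero_continuants_ne_zero l fun k hk => h k (by simp [hk])
    have ha := (h a (by simp)).ne'
    have hb := (h b (by simp)).ne'
    simp [continuants_cons_cons, ih, ha, hb]

/-- The Euclidean algorithm recovers a list from its two continuants. -/
theorem continuants_injective :
    ∀ l l' : List ℕ, Even l.length → Even l'.length → (∀ k ∈ l, 0 < k) → (∀ k ∈ l', 0 < k) →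
      continuants l = continuants l' → l = l'
  | [], [], _, _, _, _, _ => rfl
  | [_], _, h, _, _, _, _ => by simp at h
  | _, [_], _, h, _, _, _ => by simp at h
  | [], a :: b :: l, _, _, _, h, e => by
    have h0 := eval_zero_continuants_ne_zero l fun k hk => h k (by simp [hk])
    have hb := (h b (by simp)).ne'
    have := congrArg (fun p => p.2.eval 0) e
    simp [continuants, h0, hb] at this
  | a :: b :: l, [], _, _, h, _, e => by
    have h0 := eval_zero_continuants_ne_zero l fun k hk => h k (by simp [hk])
    have hb := (h b (by simp)).ne'
    have := congrArg (fun p => p.2.eval 0) e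
    simp [continuants, h0, hb] at this
  | a :: b :: l, a' :: b' :: l', he, he', h, h', e => by
    have h0 := eval_zero_continuants_ne_zero l fun k hk => h k (by simp [hk])
    have hb := (h b (by simp)).ne'
    obtain ⟨e1, e2⟩ := Prod.mk.inj e
    simp only [← e2] at e1
    have e1' := congrArg (eval 0) e1
    have e2' := congrArg (eval 0) e2
    obtain rfl : a = a' := by simpa [h0, hb] using e1'
    have e3 : (continuants l).1 = (continuants l').1 := by simpa using e1
    obtain rfl : b = b' := by
      rw [← e3] at e2'
      simpa [h0] using e2'
    have e4 : (continuants l).2 = (continuants l').2 := by simpa [e3] using e2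
    rw [continuants_injective l l' (by simpa [Nat.even_add_one] using he)
      (by simpa [Nat.even_add_one] using he') (fun k hk => h k (by simp [hk]))
      (fun k hk => h' k (by simp [hk])) (Prod.ext e3 e4)]

/-- The main part of the characteristic polynomial of the threshold graph with binary sequence
`0^{a₁} 1^{a₂} ⋯`, which remains after dividing by trivial factors `X` and `X + 1`. -/
noncomputable def mainFactor (l : List ℕ) : ℝ[X] :=
  (continuants l).1.comp (X * (X + 1)) + X * (continuants l).2.comp (X * (X + 1))

theorem eval_zero_mainFactor_ne_zero {l : List ℕ} (h : ∀ k ∈ l, 0 < k) :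
    (mainFactor l).eval 0 ≠ 0 := by
  simpa [mainFactor, eval_comp] using eval_zero_continuants_ne_zero l h

/-- If `a₁ ≠ 1`, then `-1` is no root of the main factor. If `a₁ = 1`, it is a simple root: the
first vertex then belongs to the clique formed by the vertices of the second block. -/
theorem not_sq_dvd_mainFactor {l : List ℕ} (hl : Even l.length) (h : ∀ k ∈ l, 0 < k) :
    ¬ (X + 1) ^ 2 ∣ mainFactor l := by
  match l, hl, h with
  | [], _, _ =>
    intro hd
    obtain ⟨q, hq⟩ := hd
    have := congrArg (eval (-1)) hq
    simp [mainFactor, continuants] at this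
  | [_], hl, _ => simp at hl
  | a :: b :: l, _, h =>
    have h0 := eval_zero_continuants_ne_zero l fun k hk => h k (by simp [hk])
    have hb := (h b (by simp)).ne'
    rintro ⟨q, hq⟩
    obtain rfl : a = 1 := by
      have := congrArg (eval (-1)) hq
      simp [mainFactor, continuants_cons_cons, eval_comp] at this
      have h1 : ((a : ℝ) - 1) * (b * (continuants l).1.eval 0) = 0 := by linarith
      have h2 : (a : ℝ) - 1 = 0 := by simpa [hb, h0] using h1
      exact_mod_cast sub_eq_zero.mp h2
    -- one factor `X + 1` can be split off, and the cofactor does not vanish at `-1`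
    have h1 : mainFactor (1 :: b :: l) = (X + 1) * (X * (continuants l).1.comp (X * (X + 1)) +
        (X * (X + 1) * (continuants l).2.comp (X * (X + 1)) -
          (b : ℝ[X]) * (continuants l).1.comp (X * (X + 1)))) := by
      simp [mainFactor, continuants_cons_cons]
      ring
    have hX1 : (X + 1 : ℝ[X]) ≠ 0 := X_add_C_ne_zero 1
    rw [h1, pow_two, mul_assoc (X + 1) (X + 1) q] at hq
    have := congrArg (eval (-1)) (mul_left_cancel₀ hX1 hq)
    simp [eval_comp] at this
    have h2 : ((1 : ℝ) + b) * (continuants l).1.eval 0 = 0 := by linarith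
    rcases mul_eq_zero.mp h2 with h3 | h3
    · norm_cast at h3; omega
    · exact h0 h3

theorem comp_X_mul_X_add_one_injective {p q : ℝ[X]}
    (h : p.comp (X * (X + 1)) = q.comp (X * (X + 1))) : p = q := by
  have h1 : (p - q).comp (X * (X + 1)) = 0 := by simp [h]
  rcases comp_eq_zero_iff.mp h1 with h2 | ⟨_, h2⟩
  · exact sub_eq_zero.mp h2
  · have := congrArg (fun p => p.coeff 2) h2
    simp [mul_add, ← pow_two, coeff_X] at this

/-- The two continuants are recovered by means of the involution `X ↦ -1 - X` (which corresponds
to passing to the complement): it fixes `X (X + 1)`. -/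
theorem continuants_eq_of_mainFactor_eq {l l' : List ℕ} (h : mainFactor l = mainFactor l') :
    continuants l = continuants l' := by
  have ht : (X * (X + 1) : ℝ[X]).comp (-1 - X) = X * (X + 1) := by
    simp only [mul_comp, add_comp, X_comp, one_comp]
    ring
  have h' := congrArg (fun p => p.comp (-1 - X)) h
  simp only [mainFactor, add_comp, mul_comp, X_comp, comp_assoc, ht] at h h'
  have h2 : (2 * X + 1 : ℝ[X]) ≠ 0 := by
    intro h0
    have := congrArg (eval 0) h0
    simp at this
  have hg : (continuants l).2.comp (X * (X + 1)) = (continuants l').2.comp (X * (X + 1)) := by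
    apply mul_left_cancel₀ h2
    linear_combination h - h'
  have hf : (continuants l).1.comp (X * (X + 1)) = (continuants l').1.comp (X * (X + 1)) := by
    linear_combination h - X * hg
  exact Prod.ext (comp_X_mul_X_add_one_injective hf) (comp_X_mul_X_add_one_injective hg)

/-! ### The characteristic polynomial of a block sequence -/

theorem foldl_step_replicate_false (k : ℕ) (v : ℝ[X] × ℝ[X]) :
    (List.replicate (k + 1) false).foldl step v =
      (X ^ (k + 1) * v.1, X ^ k * (X * v.2 + ((k + 1 : ℕ) : ℝ[X]) * v.1)) := by
  induction k with
  | zero => simp [step]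
  | succ k ih =>
    rw [List.replicate_succ', List.foldl_append, ih]
    simp only [List.foldl_cons, List.foldl_nil, step]
    push_cast
    ext1 <;> ring

theorem foldl_step_replicate_true (k : ℕ) (v : ℝ[X] × ℝ[X]) :
    (List.replicate (k + 1) true).foldl step v =
      ((X + 1) ^ k * ((X + 1) * v.1 - ((k + 1 : ℕ) : ℝ[X]) * v.2), (X + 1) ^ (k + 1) * v.2) := by
  induction k with
  | zero => simp [step]
  | succ k ih =>
    rw [List.replicate_succ', List.foldl_append, ih]
    simp only [List.foldl_cons, List.foldl_nil, step]
    push_cast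
    ext1 <;> ring

theorem foldl_step_replicate_false_fst (k : ℕ) (v : ℝ[X] × ℝ[X]) :
    ((List.replicate k false).foldl step v).1 = X ^ k * v.1 := by
  cases k with
  | zero => simp
  | succ k => rw [foldl_step_replicate_false]

/-- The starting vector is kept general, since the induction removes blocks from the front of
the list. -/
theorem exists_foldl_step_blockSequence (c : ℕ) : ∀ l : List ℕ, Even l.length →
    (∀ k ∈ l, 0 < k) → ∃ α β : ℕ,
      α + β + l.length = (blockSequence l ++ List.replicate c false).length ∧
      ∀ v : ℝ[X] × ℝ[X], ((blockSequence l ++ List.replicate c false).foldl step v).1 =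
        X ^ α * (X + 1) ^ β * ((continuants l).1.comp (X * (X + 1)) * v.1 +
          X * (continuants l).2.comp (X * (X + 1)) * v.2)
  | [], _, _ => ⟨c, 0, by simp [blockSequence, blocksFrom], fun v => by
      simp [blockSequence, blocksFrom, continuants, foldl_step_replicate_false_fst]⟩
  | [_], h, _ => by simp at h
  | a :: b :: l, hl, h => by
    obtain ⟨α, β, hlen, hv⟩ := exists_foldl_step_blockSequence c l
      (by simpa [Nat.even_add_one] using hl) fun k hk => h k (by simp [hk])
    have hs : blockSequence (a :: b :: l) =
      List.replicate a false ++ (List.replicate b true ++ blockSequence l) := rfl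
    obtain ⟨a, rfl⟩ := Nat.exists_eq_succ_of_ne_zero (h a (by simp)).ne'
    obtain ⟨b, rfl⟩ := Nat.exists_eq_succ_of_ne_zero (h b (by simp)).ne'
    refine ⟨α + a, β + b, ?_, fun v => ?_⟩
    · simp [hs] at hlen ⊢
      omega
    · rw [hs, List.append_assoc, List.append_assoc, List.foldl_append, List.foldl_append, hv,
        Nat.succ_eq_add_one, Nat.succ_eq_add_one, foldl_step_replicate_false,
        foldl_step_replicate_true]
      simp only [continuants_cons_cons, add_comp, sub_comp, mul_comp, X_comp, natCast_comp]
      ring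

theorem HasBinarySequence.exists_charpoly_eq {V : Type*} [Fintype V] [DecidableEq V]
    {G : SimpleGraph V} [DecidableRel G.Adj] {l : List ℕ} {c : ℕ} (hl : Even l.length)
    (hpos : ∀ k ∈ l, 0 < k)
    (h : HasBinarySequence G (blockSequence l ++ List.replicate c false)) :
    ∃ α β : ℕ, α + β + l.length = Fintype.card V ∧
      (G.adjMatrix ℝ).charpoly = X ^ α * (X + 1) ^ β * mainFactor l := by
  obtain ⟨α, β, hlen, hv⟩ := exists_foldl_step_blockSequence c l hl hpos
  refine ⟨α, β, ?_, ?_⟩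
  · obtain ⟨e, -⟩ := h
    rw [hlen, ← Fintype.card_congr e, Fintype.card_fin]
  · rw [h.charpoly_adjMatrix, hv, mul_one, mul_one, mainFactor]

/-! ### Recovering the sequence from the spectrum -/

/-- The exponents of `X` agree because the main factors do not vanish at `0`; those of `X + 1`
agree because they have the same parity and the main factors have no double root at `-1`. -/
theorem mainFactor_eq_of_mul_eq {l l' : List ℕ} (hl : Even l.length) (hl' : Even l'.length)
    (hpos : ∀ k ∈ l, 0 < k) (hpos' : ∀ k ∈ l', 0 < k) {α β α' β' : ℕ}
    (hcard : α + β + l.length = α' + β' + l'.length)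
    (h : (X ^ α * (X + 1) ^ β * mainFactor l : ℝ[X]) = X ^ α' * (X + 1) ^ β' * mainFactor l') :
    mainFactor l = mainFactor l' := by
  wlog hβ : β ≤ β' generalizing l l' α β α' β'
  · exact (this hl' hl hpos' hpos hcard.symm h.symm (le_of_not_ge hβ)).symm
  have exponent_le : ∀ {α α' : ℕ} {p q : ℝ[X]}, q.eval 0 ≠ 0 → X ^ α * p = X ^ α' * q →
      α ≤ α' := by
    intro α α' p q hq h
    by_contra hlt
    obtain ⟨d, rfl⟩ := Nat.exists_eq_add_of_lt (not_le.mp hlt)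
    rw [add_assoc, pow_add, mul_assoc] at h
    have := mul_left_cancel₀ (pow_ne_zero _ X_ne_zero) h
    exact hq (by rw [← this]; simp)
  have h0 := eval_zero_mainFactor_ne_zero hpos
  have h0' := eval_zero_mainFactor_ne_zero hpos'
  rw [mul_assoc, mul_assoc] at h
  obtain rfl : α = α' := le_antisymm (exponent_le (by simpa using h0') h)
    (exponent_le (by simpa using h0) h.symm)
  have hX1 : (X + 1 : ℝ[X]) ≠ 0 := X_add_C_ne_zero 1
  have h := mul_left_cancel₀ (pow_ne_zero _ X_ne_zero) h
  obtain ⟨d, rfl⟩ := Nat.exists_eq_add_of_le hβ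
  rw [pow_add, mul_assoc] at h
  have h := mul_left_cancel₀ (pow_ne_zero _ hX1) h
  have hd : d = 0 := by
    by_contra hd
    have h2 : 2 ≤ d := by
      obtain ⟨r, hr⟩ := hl
      obtain ⟨r', hr'⟩ := hl'
      omega
    exact not_sq_dvd_mainFactor hl hpos (h ▸ (pow_dvd_pow _ h2).mul_right _)
  simpa [hd] using h

theorem charpoly_adjMatrix_eq_of_adjSpectrum_eq {V W : Type*} [Fintype V] [DecidableEq V]
    [Fintype W] [DecidableEq W] {G : SimpleGraph V} [DecidableRel G.Adj] {G' : SimpleGraph W}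
    [DecidableRel G'.Adj] (h : adjSpectrum G = adjSpectrum G') :
    (G.adjMatrix ℝ).charpoly = (G'.adjMatrix ℝ).charpoly := by
  have hG := (G.isHermitian_adjMatrix ℝ).splits_charpoly.eq_prod_roots_of_monic
    (charpoly_monic _)
  have hG' := (G'.isHermitian_adjMatrix ℝ).splits_charpoly.eq_prod_roots_of_monic
    (charpoly_monic _)
  rw [hG, hG']
  exact congrArg (fun s : Multiset ℝ => (s.map fun a => X - C a).prod) h

theorem blocks_eq_of_adjSpectrum_eq {V W : Type*} [Fintype V] [DecidableEq V]
    [Fintype W] [DecidableEq W] {G : SimpleGraph V} [DecidableRel G.Adj] {G' : SimpleGraph W}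
    [DecidableRel G'.Adj] (hspec : adjSpectrum G = adjSpectrum G') {l l' : List ℕ} {c c' : ℕ}
    (hl : Even l.length) (hl' : Even l'.length)
    (hpos : ∀ k ∈ l, 0 < k) (hpos' : ∀ k ∈ l', 0 < k)
    (h : HasBinarySequence G (blockSequence l ++ List.replicate c false))
    (h' : HasBinarySequence G' (blockSequence l' ++ List.replicate c' false)) :
    l = l' ∧ c = c' := by
  have hchar := charpoly_adjMatrix_eq_of_adjSpectrum_eq hspec
  have hcard : Fintype.card V = Fintype.card W := by
    rw [← charpoly_natDegree_eq_dim (G.adjMatrix ℝ), hchar, charpoly_natDegree_eq_dim]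
  obtain ⟨α, β, hn, hp⟩ := h.exists_charpoly_eq hl hpos
  obtain ⟨α', β', hn', hp'⟩ := h'.exists_charpoly_eq hl' hpos'
  rw [hp, hp'] at hchar
  obtain rfl : l = l' := continuants_injective l l' hl hl' hpos hpos' <|
    continuants_eq_of_mainFactor_eq <|
      mainFactor_eq_of_mul_eq hl hl' hpos hpos' (by rw [hn, hn', hcard]) hchar
  obtain ⟨e, -⟩ := h
  obtain ⟨e', -⟩ := h'
  have := Fintype.card_congr e
  have := Fintype.card_congr e'
  simp at *
  omega

/-! ### Binary sequences of threshold graphs -/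

theorem exists_eq_replicate_append_blockSequence (s : List Bool) :
    ∃ (b : ℕ) (l : List ℕ) (c : ℕ), Even l.length ∧ (∀ k ∈ l, 0 < k) ∧
      s = List.replicate b true ++ (blockSequence l ++ List.replicate c false) := by
  induction s with
  | nil => exact ⟨0, [], 0, by simp [blockSequence, blocksFrom]⟩
  | cons d s ih =>
    obtain ⟨b, l, c, hl, hpos, rfl⟩ := ih
    cases d
    · rcases Nat.eq_zero_or_pos b with rfl | hb
      · match l, hl, hpos with
        | [], _, _ =>
          exact ⟨0, [], c + 1, by simp [blockSequence, blocksFrom, List.replicate_succ]⟩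
        | [_], hl, _ => simp at hl
        | k :: m :: l, hl, hpos =>
          refine ⟨0, (k + 1) :: m :: l, c, by simpa using hl, ?_, ?_⟩
          · simp at hpos ⊢
            exact hpos.2
          · simp [blockSequence, blocksFrom, List.replicate_succ]
      · refine ⟨0, 1 :: b :: l, c, by simpa [Nat.even_add_one] using hl, ?_, ?_⟩
        · simpa [hb] using hpos
        · simp [blockSequence, blocksFrom]
    · exact ⟨b + 1, l, c, hl, hpos, by simp [List.replicate_succ]⟩

/-- The digit of the first vertex is irrelevant, and can be taken to be `0`. -/
theorem IsThreshold.exists_hasBinarySequence {V : Type*} {G : SimpleGraph V}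
    (h : IsThreshold G) : ∃ (l : List ℕ) (c : ℕ), Even l.length ∧ (∀ k ∈ l, 0 < k) ∧
      HasBinarySequence G (blockSequence l ++ List.replicate c false) := by
  obtain ⟨s, hs, e, he⟩ := h
  obtain ⟨d, s, rfl⟩ := List.exists_cons_of_ne_nil hs
  have h0 : HasBinarySequence G (false :: s) := by
    refine ⟨e, fun i j hij => (he i j hij).trans ?_⟩
    obtain ⟨i, hi⟩ := i
    cases i with
    | zero => exact absurd hij (Nat.not_lt_zero _)
    | succ i => rfl
  obtain ⟨b, l, c, hl, hpos, hsl⟩ := exists_eq_replicate_append_blockSequence (false :: s)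
  cases b with
  | zero => exact ⟨l, c, hl, hpos, by simpa [hsl] using h0⟩
  | succ b => simp [List.replicate_succ] at hsl

theorem HasBinarySequence.nonempty_iso {V W : Type*} {G : SimpleGraph V} {G' : SimpleGraph W}
    {s : List Bool} (h : HasBinarySequence G s) (h' : HasBinarySequence G' s) :
    Nonempty (G ≃g G') := by
  obtain ⟨e, he⟩ := h
  obtain ⟨e', he'⟩ := h'
  have key : ∀ i j, G'.Adj (e' i) (e' j) ↔ G.Adj (e i) (e j) := by
    intro i j
    rcases lt_trichotomy i j with hij | rfl | hij
    · rw [he' j i hij, he j i hij]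
    · simp
    · rw [G'.adj_comm, G.adj_comm, he' i j hij, he i j hij]
  exact ⟨⟨e.symm.trans e', fun {x y} => by simpa using key (e.symm x) (e.symm y)⟩⟩

end Threshold

theorem theorem6 {V W : Type*} [Fintype V] [DecidableEq V] [Fintype W] [DecidableEq W]
    (G : SimpleGraph V) [DecidableRel G.Adj] (G' : SimpleGraph W) [DecidableRel G'.Adj]
    (hspec : Threshold.adjSpectrum G = Threshold.adjSpectrum G') :
    (Threshold.IsThreshold G → Threshold.IsThreshold G' → Nonempty (G ≃g G')) ∧
    (∀ a b : List ℕ, Even a.length → Even b.length →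
      (∀ k ∈ a, 0 < k) → (∀ k ∈ b, 0 < k) →
      Threshold.HasBinarySequence G (Threshold.blockSequence a) →
      Threshold.HasBinarySequence G' (Threshold.blockSequence b) →
      a = b) := by
  constructor
  · intro h h'
    obtain ⟨l, c, hl, hpos, hs⟩ := h.exists_hasBinarySequence
    obtain ⟨l', c', hl', hpos', hs'⟩ := h'.exists_hasBinarySequence
    obtain ⟨rfl, rfl⟩ := Threshold.blocks_eq_of_adjSpectrum_eq hspec hl hl' hpos hpos' hs hs'
    exact hs.nonempty_iso hs'
  · intro a b ha hb hpa hpb hs hs'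
    exact (Threshold.blocks_eq_of_adjSpectrum_eq (c := 0) (c' := 0) hspec ha hb hpa hpb
      (by simpa using hs) (by simpa using hs')).1
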